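/- Let $p$ be a prime. For $E\subseteq\mathbb{Z}$ let $\mathrm{Int}(E,\mathbb{Z})=\{f\in\mathbb{Q}[x] : f(E)\subseteq\mathbb{Z}\}$, let $I_n$ be the $\mathbb{Z}$-submodule of $\mathbb{Q}$ formed by $0$ and the leading coefficients of the elements of $\mathrm{Int}(E,\mathbb{Z})$ of degree at most $n$, let $\alpha_{E,p}(n)=-\inf\{\nu_p(c) : 0\neq c\in I_n\}\in[0,+\infty]$, and let $L_{E,p}=\lim_{n\to\infty}\alpha_{E,p}(n)/n\in[0,+\infty]$ be the valuative capacity of $E$ with respect to $p$. Write $[b;b_0,b_1,\dots,b_r]=b+\cfrac{1}{b_0+\cfrac{1}{b_1+\cdots+\cfrac{1}{b_r}}}$, evaluated in the extended real line with the conventions $1/0=+\infty$ and $1/(\pm\infty)=0$. Proposition. Let $m\ge 1$ and let $A_0,A_1,\dots,A_m$ be pairwise disjoint subsets of $\mathbb{Z}$ such that $\nu_p(a-b)=k$ whenever $0\le k<h\le m$, $a\in A_k$ and $b\in A_h$. Put $A=A_0\cup\dots\cup A_m$. Then the limits defining $L_{A_0,p},\dots,L_{A_m,p}$ and $L_{A,p}$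 exist in $[0,+\infty]$, and $$L_{A,p}=[0;a_0,a_1,\dots,a_{2(m-1)},a_{2m-1}],$$ where $a_{2k}=\dfrac{1}{L_{A_k,p}-k}$ for $0\le k\le m-1$, $a_{2k+1}=1$ for $0\le k<m-1$, and $a_{2m-1}=L_{A_m,p}-(m-1)$. -/

import Mathlib

open Filter Topology Polynomial

noncomputable section

namespace ValCap

/-- The ring `Int(E, ℤ)` of rational polynomials `f` with `f(E) ⊆ ℤ`. -/
def intPoly (E : Set ℤ) : Subalgebra ℤ ℚ[X] where
  carrier := {f | ∀ a ∈ E, ∃ z : ℤ, f.eval (a : ℚ) = z}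
  mul_mem' := by
    intro f g hf hg a ha
    obtain ⟨x, hx⟩ := hf a ha
    obtain ⟨y, hy⟩ := hg a ha
    exact ⟨x * y, by simp [hx, hy]⟩
  add_mem' := by
    intro f g hf hg a ha
    obtain ⟨x, hx⟩ := hf a ha
    obtain ⟨y, hy⟩ := hg a ha
    exact ⟨x + y, by simp [hx, hy]⟩
  algebraMap_mem' := by
    intro z a _
    exact ⟨z, by simp⟩

/-- The `n`-th characteristic ideal of `E`: the `ℤ`-submodule of `ℚ` formed by `0` and the leading
coefficients of the elements of `Int(E, ℤ)` of degree at most `n`.  (It is all of `ℚ` when `E` has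
at most `n` elements.) -/
def charIdeal (E : Set ℤ) (n : ℕ) : Submodule ℤ ℚ :=
  Submodule.span ℤ {c | ∃ f ∈ intPoly E, f.natDegree ≤ n ∧ f.leadingCoeff = c}

/-- The `p`-adic valuation of a `ℤ`-submodule of `ℚ`: the infimum of the valuations of its nonzero
elements; it is `-∞` when these are unbounded below. -/
def idealVal (p : ℕ) (I : Submodule ℤ ℚ) : EReal :=
  ⨅ c ∈ {c : ℚ | c ∈ I ∧ c ≠ 0}, (((padicValRat p c : ℤ) : ℝ) : EReal)

/-- The characteristic sequence `α_{E,p}(n)`, the negative of the `p`-adic valuation of the `n`-th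
characteristic ideal, with values in `[0, +∞]`. -/
def charSeq (p : ℕ) (E : Set ℤ) (n : ℕ) : EReal := -idealVal p (charIdeal E n)

/-- `L` is the limit of `α_{E,p}(n) / n` in the extended real line. -/
def HasValuativeCapacity (p : ℕ) (E : Set ℤ) (L : EReal) : Prop :=
  Tendsto (fun n : ℕ => charSeq p E n / ((n : ℝ) : EReal)) atTop (𝓝 L)

/-- The valuative capacity `L_{E,p} = lim α_{E,p}(n) / n`. -/
def valuativeCapacity (p : ℕ) (E : Set ℤ) : EReal :=
  limUnder atTop (fun n : ℕ => charSeq p E n / ((n : ℝ) : EReal))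

/-- The reciprocal on the extended real line with `1 / 0 = +∞` and `1 / (±∞) = 0`
(Mathlib's inverse on `EReal` sends `0` to `0`). -/
def recip (x : EReal) : EReal := if x = 0 then ⊤ else x⁻¹

/-- The finite continued fraction `[a; b₀, b₁, …] = a + 1 / (b₀ + 1 / (b₁ + ⋯))`. -/
def contFrac : EReal → List EReal → EReal
  | a, [] => a
  | a, b :: l => a + recip (contFrac b l)

end ValCap

end

namespace ValCap

/-! Put `B_k = A_k ∪ ⋯ ∪ A_m`. Every difference between `A_k` and `B_{k+1}` has valuation exactly
`k`, and the theorem comes from one law for such a pair: the quantities `1 / (L - k)` add under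
union (`recip_valuativeCapacity_union`). Since `L_{B_{k+1}} - k = 1 + (L_{B_{k+1}} - (k + 1))`,
applying the law at each level from `m - 1` down to `0` unrolls into the continued fraction.

The law rests on a duality. For nonempty `E`, `α(n) ≥ N` exactly when some monic polynomial of
degree `n` split over `E` has all its values on `E` divisible by `p ^ N` (`le_charSeq_iff`); failure
is certified by `n + 1` points of `E` for which no Lagrange denominator is divisible by `p ^ N`. The
least degree at which `α(n) ≥ t + k * n` is asymptotic to `t / (L - k)`. For a union at mutual
valuation `k` these degrees add exactly (`crossing_union`): products of polynomials give one
inequality, unions of certificates the other. -/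

/-! ### Duality between split polynomials and finite certificates -/

/-- Some monic polynomial of degree `n` with all its roots in `E` takes on `E` only values divisible
by `p ^ N`. -/
def RootBound (p : ℕ) (E : Set ℤ) (n N : ℕ) : Prop :=
  ∃ T : Multiset ℤ, (∀ j ∈ T, j ∈ E) ∧ T.card = n ∧
    ∀ x ∈ E, (p : ℤ) ^ N ∣ (T.map fun j => x - j).prod

theorem pow_dvd_prod_iff_le_sum_padicValInt {p : ℕ} [Fact p.Prime] {ι : Type*} (R : Finset ι)
    (f : ι → ℤ) (hf : ∀ j ∈ R, f j ≠ 0) (N : ℕ) :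
    (p : ℤ) ^ N ∣ ∏ j ∈ R, f j ↔ N ≤ ∑ j ∈ R, padicValInt p (f j) := by
  classical
  have key : padicValInt p (∏ j ∈ R, f j) = ∑ j ∈ R, padicValInt p (f j) := by
    induction R using Finset.induction_on with
    | empty => simp
    | insert a s ha ih =>
      rw [Finset.prod_insert ha, Finset.sum_insert ha, padicValInt.mul, ih]
      · exact fun j hj => hf j (Finset.mem_insert_of_mem hj)
      · exact hf a (Finset.mem_insert_self _ _)
      · exact Finset.prod_ne_zero_iff.2 fun j hj => hf j (Finset.mem_insert_of_mem hj)
  rw [padicValInt_dvd_iff, key]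
  simp [Finset.prod_ne_zero_iff.2 hf]

theorem padicValInt_sub_comm {p : ℕ} (x y : ℤ) : padicValInt p (x - y) = padicValInt p (y - x) := by
  rw [padicValInt, padicValInt, ← Int.natAbs_neg, neg_sub]

/-- A finite subset of `E` minimizing the valuation of the Vandermonde determinant. -/
theorem exists_fekete {p : ℕ} [Fact p.Prime] {E : Set ℤ} {n : ℕ}
    (h : ∃ S : Finset ℤ, ↑S ⊆ E ∧ S.card = n + 1) :
    ∃ S : Finset ℤ, ↑S ⊆ E ∧ S.card = n + 1 ∧ ∀ i ∈ S, ∀ x ∈ E, x ∉ S.erase i →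
      ∑ j ∈ S.erase i, padicValInt p (i - j) ≤ ∑ j ∈ S.erase i, padicValInt p (x - j) := by
  -- Each unordered pair counts twice, and the diagonal adds nothing because `padicValInt p 0 = 0`.
  let w : Finset ℤ → ℕ := fun S => ∑ i ∈ S, ∑ j ∈ S, padicValInt p (i - j)
  have hw : ∀ (R : Finset ℤ) (x : ℤ), x ∉ R →
      w (insert x R) = w R + 2 * ∑ j ∈ R, padicValInt p (x - j) := by
    intro R x hx
    simp only [w, Finset.sum_insert hx, Finset.sum_add_distrib, sub_self, padicValInt.zero,
      padicValInt_sub_comm _ x]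
    ring
  obtain ⟨S, ⟨hSE, hSc⟩, hmin⟩ := exists_minimalFor_of_wellFoundedLT
    (fun S : Finset ℤ => ↑S ⊆ E ∧ S.card = n + 1) w h
  refine ⟨S, hSE, hSc, fun i hi x hx hxS => ?_⟩
  have h1 : w S ≤ w (insert x (S.erase i)) := by
    refine le_of_not_gt fun hlt => ?_
    refine absurd (hmin (j := insert x (S.erase i)) ⟨?_, ?_⟩ hlt.le) (not_le.2 hlt)
    · intro y hy
      rcases Finset.mem_insert.1 (Finset.mem_coe.1 hy) with rfl | hy
      · exact hx
      · exact hSE (Finset.mem_of_mem_erase hy)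
    · rw [Finset.card_insert_of_notMem hxS, Finset.card_erase_of_mem hi, hSc]
      rfl
  have h2 := hw (S.erase i) i (Finset.notMem_erase i S)
  rw [Finset.insert_erase hi] at h2
  have h3 := hw (S.erase i) x hxS
  omega

/-- Take `S` of minimal Vandermonde valuation. For each `i ∈ S`, the polynomial with roots `S \ {i}`
attains its least valuation on `E` at `i`. So one divisible denominator yields a polynomial, and
otherwise `S` itself is the certificate. -/
theorem rootBound_or_exists_finset {p : ℕ} [Fact p.Prime] {E : Set ℤ} (hE : E.Nonempty)
    (n N : ℕ) :
    RootBound p E n N ∨ ∃ S : Finset ℤ, ↑S ⊆ E ∧ S.card = n + 1 ∧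
      ∀ i ∈ S, ¬ (p : ℤ) ^ N ∣ ∏ j ∈ S.erase i, (i - j) := by
  by_cases h : ∃ S : Finset ℤ, ↑S ⊆ E ∧ S.card = n + 1
  · obtain ⟨S, hSE, hSc, hS⟩ := exists_fekete (p := p) h
    by_cases hd : ∃ i ∈ S, (p : ℤ) ^ N ∣ ∏ j ∈ S.erase i, (i - j)
    · obtain ⟨i, hi, hd⟩ := hd
      left
      refine ⟨(S.erase i).val, fun j hj => hSE (Finset.mem_of_mem_erase hj), ?_, fun x hx => ?_⟩
      · rw [Finset.card_val, Finset.card_erase_of_mem hi, hSc]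
        rfl
      change _ ∣ ∏ j ∈ S.erase i, (x - j)
      by_cases hxS : x ∈ S.erase i
      · rw [Finset.prod_eq_zero hxS (sub_self x)]
        exact dvd_zero _
      · rw [pow_dvd_prod_iff_le_sum_padicValInt] at hd ⊢
        · exact hd.trans (hS i hi x hx hxS)
        · intro j hj h0
          exact hxS (sub_eq_zero.1 h0 ▸ hj)
        · intro j hj h0
          exact Finset.ne_of_mem_erase hj (sub_eq_zero.1 h0).symm
    · right
      push Not at hd
      exact ⟨S, hSE, hSc, hd⟩
  · left
    have hfin : E.Finite := by
      by_contra hinf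
      obtain ⟨S, h1, h2⟩ := Set.Infinite.exists_subset_card_eq hinf (n + 1)
      exact h ⟨S, h1, h2⟩
    obtain ⟨e, he⟩ := hE
    have hcard : hfin.toFinset.card ≤ n := by
      by_contra hlt
      obtain ⟨S, h1, h2⟩ := Finset.exists_subset_card_eq (s := hfin.toFinset) (n := n + 1) (by omega)
      exact h ⟨S, fun x hx => hfin.mem_toFinset.1 (h1 hx), h2⟩
    -- With at most `n` points, use the polynomial vanishing on all of `E`, padded to degree `n` by
    -- repeating `e`.
    refine ⟨hfin.toFinset.val + Multiset.replicate (n - hfin.toFinset.card) e, ?_, ?_, ?_⟩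
    · intro j hj
      rcases Multiset.mem_add.1 hj with hj | hj
      · exact hfin.mem_toFinset.1 hj
      · exact Multiset.eq_of_mem_replicate hj ▸ he
    · simp only [Multiset.card_add, Finset.card_val, Multiset.card_replicate]
      omega
    · intro x hx
      rw [Multiset.map_add, Multiset.prod_add]
      have : (hfin.toFinset.val.map fun j => x - j).prod = 0 :=
        Finset.prod_eq_zero (hfin.mem_toFinset.2 hx) (sub_self x)
      simp [this]

/-- By Lagrange interpolation the leading coefficient is a sum of integers `f(i)` over denominators
of norm greater than `p ^ (-N)`; the ultrametric inequality concludes. -/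
theorem padicNorm_leadingCoeff_lt {p : ℕ} [Fact p.Prime] {E : Set ℤ} {n N : ℕ} {S : Finset ℤ}
    (hSE : ↑S ⊆ E) (hSc : S.card = n + 1)
    (hS : ∀ i ∈ S, ¬ (p : ℤ) ^ N ∣ ∏ j ∈ S.erase i, (i - j))
    {f : ℚ[X]} (hf : f ∈ intPoly E) (hd : f.natDegree ≤ n) :
    padicNorm p f.leadingCoeff < (p : ℚ) ^ N := by
  have hp0 : (0 : ℚ) < p := by exact_mod_cast (Fact.out : p.Prime).pos
  have hpN : (0 : ℚ) < (p : ℚ) ^ N := pow_pos hp0 N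
  rcases eq_or_ne f 0 with rfl | hf0
  · simpa using hpN
  -- Interpolation at `n + 1` points reads off the coefficient of degree exactly `n`; a power of `X`
  -- raises the degree and keeps the values integral.
  set g : ℚ[X] := f * X ^ (n - f.natDegree) with hg
  have hgd : g.natDegree = n := by
    rw [hg, natDegree_mul_X_pow _ hf0]
    omega
  have hgl : g.leadingCoeff = f.leadingCoeff := by simp [hg]
  have hgE : ∀ a ∈ E, ∃ z : ℤ, g.eval (a : ℚ) = z := by
    intro a ha
    obtain ⟨z, hz⟩ := hf a ha
    exact ⟨z * a ^ (n - f.natDegree), by simp [hg, hz]⟩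
  have hg0 : g ≠ 0 := by
    intro h0
    rw [h0, leadingCoeff_zero] at hgl
    exact hf0 (leadingCoeff_eq_zero.1 hgl.symm)
  have hsum := Lagrange.leadingCoeff_eq_sum (s := S) (v := fun i : ℤ => (i : ℚ)) (P := g)
    (fun a _ b _ h => Int.cast_injective h)
    (by rw [hSc, degree_eq_natDegree hg0, hgd]; rfl)
  rw [← hgl, hsum]
  refine padicNorm.sum_lt' (fun i hi => ?_) hpN
  obtain ⟨z, hz⟩ := hgE i (hSE hi)
  have hD : (∏ j ∈ S.erase i, ((i : ℚ) - (j : ℚ))) = ((∏ j ∈ S.erase i, (i - j) : ℤ) : ℚ) := by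
    push_cast
    rfl
  have h1 : ((p : ℚ) ^ N)⁻¹ < padicNorm p ((∏ j ∈ S.erase i, (i - j) : ℤ) : ℚ) := by
    have := hS i hi
    rw [← Nat.cast_pow, padicNorm.dvd_iff_norm_le, not_le, zpow_neg, zpow_natCast] at this
    exact this
  rw [hz, hD, padicNorm.div]
  have h2 := lt_trans (inv_pos.2 hpN) h1
  rw [div_lt_iff₀ h2]
  calc padicNorm p z ≤ 1 := padicNorm.of_int z
    _ = (p : ℚ) ^ N * ((p : ℚ) ^ N)⁻¹ := (mul_inv_cancel₀ hpN.ne').symm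
    _ < _ := mul_lt_mul_of_pos_left h1 hpN

theorem padicNorm_lt_pow_iff {p : ℕ} [Fact p.Prime] {c : ℚ} (hc : c ≠ 0) (N : ℕ) :
    padicNorm p c < (p : ℚ) ^ N ↔ -(N : ℤ) < padicValRat p c := by
  rw [padicNorm.eq_zpow_of_nonzero hc, ← zpow_natCast,
    zpow_lt_zpow_iff_right₀ (by exact_mod_cast (Fact.out : p.Prime).one_lt)]
  omega

theorem not_le_charSeq {p : ℕ} [Fact p.Prime] {E : Set ℤ} {n N : ℕ} {S : Finset ℤ}
    (hSE : ↑S ⊆ E) (hSc : S.card = n + 1)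
    (hS : ∀ i ∈ S, ¬ (p : ℤ) ^ N ∣ ∏ j ∈ S.erase i, (i - j)) :
    ¬ (((N : ℝ) : EReal) ≤ charSeq p E n) := by
  have hp0 : (0 : ℚ) < p := by exact_mod_cast (Fact.out : p.Prime).pos
  have hpN : (0 : ℚ) < (p : ℚ) ^ N := pow_pos hp0 N
  have key : ∀ c ∈ charIdeal E n, padicNorm p c < (p : ℚ) ^ N := by
    intro c hc
    refine Submodule.span_induction (p := fun c _ => padicNorm p c < (p : ℚ) ^ N) ?_ ?_ ?_ ?_ hc
    · rintro c ⟨f, hf, hd, rfl⟩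
      exact padicNorm_leadingCoeff_lt hSE hSc hS hf hd
    · simpa using hpN
    · intro x y _ _ hx hy
      exact lt_of_le_of_lt padicNorm.nonarchimedean (max_lt hx hy)
    · intro z x _ hx
      rw [zsmul_eq_mul, padicNorm.mul]
      exact lt_of_le_of_lt (mul_le_of_le_one_left (padicNorm.nonneg _) (padicNorm.of_int z)) hx
  -- Integrality of valuations turns the strict bound `> -N` into `≥ 1 - N`, which survives the
  -- infimum.
  have hle : (((1 - (N : ℝ) : ℝ)) : EReal) ≤ idealVal p (charIdeal E n) := by
    refine le_iInf₂ fun c hc => ?_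
    have h1 := (padicNorm_lt_pow_iff hc.2 N).1 (key c hc.1)
    have h2 : (1 - (N : ℤ)) ≤ padicValRat p c := by omega
    exact_mod_cast h2
  rw [not_le, charSeq, EReal.neg_lt_comm]
  refine lt_of_lt_of_le ?_ hle
  rw [← EReal.coe_neg, EReal.coe_lt_coe_iff]
  linarith

theorem le_charSeq_of_pow_dvd {p : ℕ} [Fact p.Prime] {E : Set ℤ} {N : ℕ} (T : Multiset ℤ)
    (hT : ∀ x ∈ E, (p : ℤ) ^ N ∣ (T.map fun j => x - j).prod) :
    ((N : ℝ) : EReal) ≤ charSeq p E T.card := by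
  have hp0 : (p : ℚ) ≠ 0 := by exact_mod_cast (Fact.out : p.Prime).ne_zero
  have hc0 : ((p : ℚ) ^ N)⁻¹ ≠ 0 := inv_ne_zero (pow_ne_zero _ hp0)
  have hmon : ((T.map fun j : ℤ => X - C (j : ℚ)).prod).Monic :=
    monic_multiset_prod_of_monic _ _ fun j _ => monic_X_sub_C _
  have hmem : ((p : ℚ) ^ N)⁻¹ ∈ charIdeal E T.card := by
    refine Submodule.subset_span
      ⟨C ((p : ℚ) ^ N)⁻¹ * (T.map fun j : ℤ => X - C (j : ℚ)).prod, ?_, ?_, ?_⟩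
    · intro a ha
      obtain ⟨z, hz⟩ := hT a ha
      refine ⟨z, ?_⟩
      have h1 : ((T.map fun j : ℤ => X - C (j : ℚ)).prod).eval (a : ℚ)
          = (((T.map fun j => a - j).prod : ℤ) : ℚ) := by
        rw [eval_multiset_prod, Multiset.map_map, Int.cast_multiset_prod, Multiset.map_map]
        simp
      rw [eval_mul, eval_C, h1, hz]
      push_cast
      field_simp
    · refine (natDegree_C_mul_le _ _).trans ?_
      have := natDegree_multiset_prod_X_sub_C_eq_card (T.map fun j : ℤ => (j : ℚ))
      rw [Multiset.map_map, Multiset.card_map] at this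
      exact this.le
    · rw [leadingCoeff_mul, leadingCoeff_C, hmon.leadingCoeff, mul_one]
  rw [charSeq, EReal.le_neg]
  refine (iInf₂_le _ (show ((p : ℚ) ^ N)⁻¹ ∈ {c : ℚ | c ∈ charIdeal E T.card ∧ c ≠ 0} from
    ⟨hmem, hc0⟩)).trans ?_
  rw [padicValRat.inv, padicValRat.pow, padicValRat.self (Fact.out : p.Prime).one_lt]
  simp

/-- The characteristic sequence is governed by polynomials split over `E`. -/
theorem le_charSeq_iff {p : ℕ} [Fact p.Prime] {E : Set ℤ} (hE : E.Nonempty) (n N : ℕ) :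
    ((N : ℝ) : EReal) ≤ charSeq p E n ↔ RootBound p E n N := by
  constructor
  · intro h
    rcases rootBound_or_exists_finset (p := p) hE n N with h1 | ⟨S, h1, h2, h3⟩
    · exact h1
    · exact absurd h (not_le_charSeq h1 h2 h3)
  · rintro ⟨T, _, rfl, h⟩
    exact le_charSeq_of_pow_dvd T h

theorem rootBound_iff_not_exists_finset {p : ℕ} [Fact p.Prime] {E : Set ℤ} (hE : E.Nonempty)
    (n N : ℕ) :
    ¬ RootBound p E n N ↔ ∃ S : Finset ℤ, ↑S ⊆ E ∧ S.card = n + 1 ∧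
      ∀ i ∈ S, ¬ (p : ℤ) ^ N ∣ ∏ j ∈ S.erase i, (i - j) := by
  constructor
  · exact (rootBound_or_exists_finset hE n N).resolve_left
  · rintro ⟨S, h1, h2, h3⟩
    rw [← le_charSeq_iff hE]
    exact not_le_charSeq h1 h2 h3

/-! ### Superadditivity and existence of the capacity -/

theorem rootBound_zero_right {p : ℕ} {E : Set ℤ} (hE : E.Nonempty) (n : ℕ) :
    RootBound p E n 0 := by
  obtain ⟨e, he⟩ := hE
  exact ⟨Multiset.replicate n e, fun j hj => Multiset.eq_of_mem_replicate hj ▸ he, by simp,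
    by simp⟩

theorem RootBound.pos {p : ℕ} [Fact p.Prime] {E : Set ℤ} (hE : E.Nonempty) {n N : ℕ}
    (h : RootBound p E n N) (hN : 0 < N) : 0 < n := by
  rw [Nat.pos_iff_ne_zero]
  rintro rfl
  obtain ⟨T, -, hT, h⟩ := h
  obtain ⟨e, he⟩ := hE
  have := h e he
  rw [Multiset.card_eq_zero.1 hT] at this
  have h1 : (p : ℤ) ∣ 1 := (dvd_pow_self _ hN.ne').trans (by simpa using this)
  exact (Fact.out : p.Prime).ne_one (Nat.dvd_one.1 (by exact_mod_cast h1))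

theorem RootBound.add {p : ℕ} {E : Set ℤ} {m n M N : ℕ} (h : RootBound p E m M)
    (h' : RootBound p E n N) : RootBound p E (m + n) (M + N) := by
  obtain ⟨T, h1, rfl, h3⟩ := h
  obtain ⟨T', h1', rfl, h3'⟩ := h'
  refine ⟨T + T', ?_, by simp, fun x hx => ?_⟩
  · intro j hj
    rcases Multiset.mem_add.1 hj with hj | hj
    exacts [h1 j hj, h1' j hj]
  · rw [Multiset.map_add, Multiset.prod_add, pow_add]
    exact mul_dvd_mul (h3 x hx) (h3' x hx)

theorem RootBound.mono {p : ℕ} {E : Set ℤ} (hE : E.Nonempty) {m n M N : ℕ}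
    (h : RootBound p E m M) (hmn : m ≤ n) (hNM : N ≤ M) : RootBound p E n N := by
  obtain ⟨k, rfl⟩ := Nat.exists_eq_add_of_le hmn
  obtain ⟨T, h1, h2, h3⟩ := h.add (rootBound_zero_right hE k)
  exact ⟨T, h1, h2, fun x hx => (pow_dvd_pow _ (by omega)).trans (h3 x hx)⟩

theorem RootBound.mul {p : ℕ} {E : Set ℤ} (hE : E.Nonempty) {m M : ℕ}
    (h : RootBound p E m M) (q : ℕ) : RootBound p E (q * m) (q * M) := by
  induction q with
  | zero => simpa using rootBound_zero_right hE 0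
  | succ q ih =>
    rw [Nat.succ_mul, Nat.succ_mul]
    exact ih.add h

theorem charSeq_empty {p : ℕ} [Fact p.Prime] (n : ℕ) : charSeq p ∅ n = ⊤ := by
  refine EReal.eq_top_iff_forall_lt _ |>.2 fun y => ?_
  obtain ⟨N, hN⟩ := exists_nat_gt y
  have h := le_charSeq_of_pow_dvd (p := p) (E := ∅) (N := N) (Multiset.replicate n 0) (by simp)
  rw [Multiset.card_replicate] at h
  exact lt_of_lt_of_le (by exact_mod_cast hN) h

theorem exists_rootBound_of_lt_charSeq {p : ℕ} [Fact p.Prime] {E : Set ℤ} (hE : E.Nonempty)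
    {n : ℕ} {x : ℝ} (hx : (x : EReal) < charSeq p E n) :
    ∃ N : ℕ, x < N ∧ RootBound p E n N := by
  have h := hx
  rw [charSeq, EReal.lt_neg_comm, idealVal] at h
  obtain ⟨c, h⟩ := iInf_lt_iff.1 h
  obtain ⟨hc, hlt⟩ := iInf_lt_iff.1 h
  rw [← EReal.coe_neg, EReal.coe_lt_coe_iff] at hlt
  have hle : ((-(padicValRat p c : ℝ) : ℝ) : EReal) ≤ charSeq p E n := by
    rw [charSeq, EReal.coe_neg]
    exact EReal.neg_le_neg_iff.2 (iInf₂_le c hc)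
  rcases le_total (padicValRat p c) 0 with h0 | h0
  · obtain ⟨N, hN⟩ := Int.eq_ofNat_of_zero_le (neg_nonneg.2 h0)
    have hN' : -(padicValRat p c : ℝ) = N := by exact_mod_cast hN
    refine ⟨N, by linarith, (le_charSeq_iff hE n N).1 (hN' ▸ hle)⟩
  · refine ⟨0, ?_, rootBound_zero_right hE n⟩
    have : (0 : ℝ) ≤ padicValRat p c := by exact_mod_cast h0
    push_cast
    linarith

/-- Fekete's superadditivity argument: products of polynomials make the limit the supremum of the
attainable ratios `N / n`. -/
theorem exists_hasValuativeCapacity {p : ℕ} [Fact p.Prime] {E : Set ℤ} (hE : E.Nonempty) :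
    ∃ L : EReal, HasValuativeCapacity p E L ∧
      (∀ n N : ℕ, 0 < n → RootBound p E n N → (((N : ℝ) / n : ℝ) : EReal) ≤ L) ∧
      (∀ l : ℝ, (l : EReal) < L → ∀ᶠ n : ℕ in atTop, RootBound p E n ⌈l * n⌉₊) := by
  set L : EReal := sSup {x | ∃ n N : ℕ, 0 < n ∧ RootBound p E n N ∧ x = (((N : ℝ) / n : ℝ) : EReal)}
    with hL
  have h1 : ∀ n N : ℕ, 0 < n → RootBound p E n N → (((N : ℝ) / n : ℝ) : EReal) ≤ L :=
    fun n N hn h => le_sSup ⟨n, N, hn, h, rfl⟩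
  have h2 : ∀ l : ℝ, (l : EReal) < L → ∀ᶠ n : ℕ in atTop, RootBound p E n ⌈l * n⌉₊ := by
    intro l hl
    obtain ⟨_, ⟨d, N, hd, hR, rfl⟩, hlt⟩ := lt_sSup_iff.1 hl
    rw [EReal.coe_lt_coe_iff] at hlt
    have hd' : (0 : ℝ) < d := by exact_mod_cast hd
    have hev : ∀ᶠ n : ℕ in atTop, (N : ℝ) / (N / d - l) ≤ n :=
      tendsto_natCast_atTop_atTop.eventually_ge_atTop _
    filter_upwards [hev] with n hn
    -- Using `n / d` copies loses at most `N` to the remainder, which the gap `N / d - l` absorbs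
    -- once `n` is large.
    refine (hR.mul hE (n / d)).mono hE (Nat.div_mul_le_self n d) (Nat.ceil_le.2 ?_)
    rw [div_le_iff₀ (sub_pos.2 hlt)] at hn
    have hq : (n : ℝ) / d ≤ (n / d : ℕ) + 1 := by
      rw [div_le_iff₀ hd']
      have := (Nat.lt_div_mul_add (a := n) hd).le
      have h3 : (n : ℝ) ≤ (n / d : ℕ) * d + d := by exact_mod_cast this
      linarith
    have h4 := mul_le_mul_of_nonneg_right hq (Nat.cast_nonneg (α := ℝ) N)
    have h5 : (n : ℝ) / d * N = n * (N / d) := by ring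
    push_cast
    linarith
  refine ⟨L, ?_, h1, h2⟩
  refine tendsto_order.2 ⟨fun a ha => ?_, fun b hb => ?_⟩
  · obtain ⟨l, hal, hlL⟩ := EReal.lt_iff_exists_real_btwn.1 ha
    filter_upwards [h2 l hlL, eventually_gt_atTop 0] with n hn hn0
    have hn0' : (0 : ℝ) < n := by exact_mod_cast hn0
    refine hal.trans_le ?_
    rw [EReal.le_div_iff_mul_le (by exact_mod_cast hn0') (EReal.coe_ne_top _)]
    refine le_trans ?_ ((le_charSeq_iff hE _ _).2 hn)
    rw [← EReal.coe_mul, EReal.coe_le_coe_iff]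
    exact Nat.le_ceil _
  · filter_upwards [eventually_gt_atTop 0] with n hn0
    have hn0' : (0 : ℝ) < n := by exact_mod_cast hn0
    refine lt_of_le_of_lt (le_of_not_gt fun hlt => ?_) hb
    obtain ⟨r, hLr, hr⟩ := EReal.lt_iff_exists_real_btwn.1 hlt
    rw [EReal.lt_div_iff (by exact_mod_cast hn0') (EReal.coe_ne_top _), ← EReal.coe_mul] at hr
    obtain ⟨N, hN, hR⟩ := exists_rootBound_of_lt_charSeq hE hr
    have h3 := (h1 n N hn0 hR).trans_lt hLr
    rw [EReal.coe_lt_coe_iff, div_lt_iff₀ hn0'] at h3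
    linarith

theorem hasValuativeCapacity_empty {p : ℕ} [Fact p.Prime] :
    HasValuativeCapacity p ∅ ⊤ := by
  refine tendsto_const_nhds.congr' ?_
  filter_upwards [eventually_gt_atTop 0] with n hn
  rw [charSeq_empty, EReal.top_div_of_pos_ne_top (by exact_mod_cast hn) (EReal.coe_ne_top _)]

theorem hasValuativeCapacity_valuativeCapacity {p : ℕ} [Fact p.Prime] (E : Set ℤ) :
    HasValuativeCapacity p E (valuativeCapacity p E) := by
  rcases E.eq_empty_or_nonempty with rfl | hE
  · exact tendsto_nhds_limUnder ⟨_, hasValuativeCapacity_empty⟩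
  · obtain ⟨L, h, _⟩ := exists_hasValuativeCapacity (p := p) hE
    exact tendsto_nhds_limUnder ⟨L, h⟩

theorem HasValuativeCapacity.eq {p : ℕ} [Fact p.Prime] {E : Set ℤ} {L : EReal}
    (h : HasValuativeCapacity p E L) : valuativeCapacity p E = L :=
  tendsto_nhds_unique (hasValuativeCapacity_valuativeCapacity E) h

theorem valuativeCapacity_empty {p : ℕ} [Fact p.Prime] : valuativeCapacity p ∅ = ⊤ :=
  hasValuativeCapacity_empty.eq

theorem div_le_valuativeCapacity {p : ℕ} [Fact p.Prime] {E : Set ℤ} {n N : ℕ} (hE : E.Nonempty)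
    (hn : 0 < n) (h : RootBound p E n N) :
    (((N : ℝ) / n : ℝ) : EReal) ≤ valuativeCapacity p E := by
  obtain ⟨L, hL, h1, _⟩ := exists_hasValuativeCapacity (p := p) hE
  exact hL.eq ▸ h1 n N hn h

theorem eventually_rootBound {p : ℕ} [Fact p.Prime] {E : Set ℤ} (hE : E.Nonempty) {l : ℝ}
    (h : (l : EReal) < valuativeCapacity p E) : ∀ᶠ n : ℕ in atTop, RootBound p E n ⌈l * n⌉₊ := by
  obtain ⟨L, hL, _, h2⟩ := exists_hasValuativeCapacity (p := p) hE
  exact h2 l (hL.eq ▸ h)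

theorem valuativeCapacity_ne_bot {p : ℕ} [Fact p.Prime] (E : Set ℤ) :
    valuativeCapacity p E ≠ ⊥ := by
  rcases E.eq_empty_or_nonempty with rfl | hE
  · simp [valuativeCapacity_empty]
  · have := div_le_valuativeCapacity (p := p) hE one_pos (rootBound_zero_right hE 1)
    exact ((EReal.bot_lt_coe _).trans_le this).ne'

/-- Sets contained in one residue class modulo `p ^ k` have capacity greater than `k`. -/
theorem lt_valuativeCapacity {p : ℕ} [Fact p.Prime] {E : Set ℤ} (hE : E.Nonempty) {k : ℕ}
    (h : ∀ x ∈ E, ∀ y ∈ E, (p : ℤ) ^ k ∣ x - y) :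
    ((k : ℝ) : EReal) < valuativeCapacity p E := by
  have hp := (Fact.out : p.Prime)
  obtain ⟨e, he⟩ := hE
  have hR : RootBound p E p (k * p + 1) := by
    -- The roots chosen next need not lie in `E`; passing through `charSeq` lifts that restriction.
    -- They cover all residues of `(x - e) / p ^ k` modulo `p`, whence the extra factor `p`.
    rw [← le_charSeq_iff ⟨e, he⟩]
    have := le_charSeq_of_pow_dvd (p := p) (E := E) (N := k * p + 1)
      ((Multiset.range p).map fun i : ℕ => e + p ^ k * (i : ℤ)) ?_
    · simpa using this
    · intro x hx
      obtain ⟨y, hy⟩ := h x hx e he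
      rw [Multiset.map_map]
      have h1 : (Multiset.map ((fun j => x - j) ∘ fun i : ℕ => e + p ^ k * (i : ℤ))
          (Multiset.range p)).prod = ∏ i ∈ Finset.range p, ((p : ℤ) ^ k * (y - i)) := by
        change ∏ i ∈ Finset.range p, (x - (e + p ^ k * (i : ℤ))) = _
        refine Finset.prod_congr rfl fun i _ => ?_
        linear_combination hy
      rw [h1, Finset.prod_mul_distrib, Finset.prod_const, Finset.card_range, ← pow_mul, pow_succ]
      refine mul_dvd_mul_left _ ?_
      have hp0 : (0 : ℤ) < p := by exact_mod_cast hp.pos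
      obtain ⟨i, hi⟩ := Int.eq_ofNat_of_zero_le (Int.emod_nonneg y hp0.ne')
      refine dvd_trans ?_ (Finset.dvd_prod_of_mem (fun i : ℕ => y - (i : ℤ)) (a := i) ?_)
      · exact hi ▸ Int.dvd_self_sub_emod
      · have := Int.emod_lt_of_pos y hp0
        rw [Finset.mem_range]
        omega
  refine lt_of_lt_of_le ?_ (div_le_valuativeCapacity ⟨e, he⟩ hp.pos hR)
  have hp0 : (0 : ℝ) < p := by exact_mod_cast hp.pos
  rw [EReal.coe_lt_coe_iff, lt_div_iff₀ hp0]
  push_cast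
  linarith

/-! ### Reciprocals and crossing degrees -/

theorem recip_coe_of_ne_zero {x : ℝ} (hx : x ≠ 0) : recip (x : EReal) = ((x⁻¹ : ℝ) : EReal) := by
  rw [recip, if_neg (by exact_mod_cast hx), EReal.coe_inv]

theorem recip_top : recip ⊤ = 0 := by simp [recip]

theorem recip_recip {x : EReal} (hx : x ≠ ⊥) : recip (recip x) = x := by
  induction x with
  | bot => exact absurd rfl hx
  | top => simp [recip]
  | coe x =>
    rcases eq_or_ne x 0 with rfl | h
    · simp [recip]
    · rw [recip_coe_of_ne_zero h, recip_coe_of_ne_zero (inv_ne_zero h), inv_inv]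

/-- The least degree `n` at which the characteristic sequence exceeds `k * n` by `t`. -/
noncomputable def crossing (p : ℕ) (E : Set ℤ) (k t : ℕ) : ℕ :=
  sInf {n | RootBound p E n (t + k * n)}

theorem exists_crossing_bounds {p : ℕ} [Fact p.Prime] {E : Set ℤ} (hE : E.Nonempty) {k : ℕ}
    (hk : ((k : ℝ) : EReal) < valuativeCapacity p E) :
    ∃ r : ℝ, (r : EReal) = recip (valuativeCapacity p E - ((k : ℝ) : EReal)) ∧
      (∀ n t : ℕ, 0 < t → RootBound p E n (t + k * n) → r * t ≤ n) ∧
      ∀ b, r < b → ∃ l : ℝ, 0 < l ∧ ((l + k : ℝ) : EReal) < valuativeCapacity p E ∧ 1 / l < b := by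
  have hdiv := fun n N hn h => div_le_valuativeCapacity (p := p) (n := n) (N := N) hE hn h
  generalize valuativeCapacity p E = L at hk hdiv
  induction L with
  | bot => simp at hk
  | top =>
    refine ⟨0, by rw [EReal.top_sub_coe, recip_top, EReal.coe_zero], by simp, fun b hb =>
      ⟨2 / b, by positivity, ?_, ?_⟩⟩
    · exact EReal.coe_lt_top _
    · rw [one_div_div]
      linarith
  | coe L =>
    rw [EReal.coe_lt_coe_iff] at hk
    have hpos : 0 < L - k := sub_pos.2 hk
    refine ⟨(L - k)⁻¹, ?_, fun n t ht h => ?_, fun b hb => ?_⟩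
    · rw [← EReal.coe_sub, recip_coe_of_ne_zero hpos.ne']
    · have hn := h.pos hE (by omega)
      have h1 := hdiv n _ hn h
      have hn' : (0 : ℝ) < n := by exact_mod_cast hn
      rw [EReal.coe_le_coe_iff, div_le_iff₀ hn'] at h1
      push_cast at h1
      rw [inv_mul_le_iff₀ hpos]
      linarith
    · have hb0 : 0 < b := (inv_pos.2 hpos).trans hb
      obtain ⟨l, h1, h2⟩ := exists_between (inv_lt_of_inv_lt₀ hpos hb)
      have hl : 0 < l := (inv_pos.2 hb0).trans h1
      refine ⟨l, hl, ?_, ?_⟩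
      · rw [EReal.coe_lt_coe_iff]
        linarith
      · rw [one_div]
        exact inv_lt_of_inv_lt₀ hb0 h1

theorem rootBound_of_lt {p : ℕ} [Fact p.Prime] {E : Set ℤ} (hE : E.Nonempty) {k : ℕ} {l : ℝ}
    (hl : ((l + k : ℝ) : EReal) < valuativeCapacity p E) :
    ∀ᶠ n : ℕ in atTop, ∀ t : ℕ, (t : ℝ) ≤ l * n → RootBound p E n (t + k * n) := by
  filter_upwards [eventually_rootBound hE hl] with n hn t ht
  refine hn.mono hE le_rfl ?_
  have : ((t + k * n : ℕ) : ℝ) ≤ ⌈(l + k) * n⌉₊ := by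
    refine le_trans ?_ (Nat.le_ceil _)
    push_cast
    linarith
  exact_mod_cast this

theorem crossing_spec {p : ℕ} [Fact p.Prime] {E : Set ℤ} (hE : E.Nonempty) {k : ℕ}
    (hk : ((k : ℝ) : EReal) < valuativeCapacity p E) (t : ℕ) :
    RootBound p E (crossing p E k t) (t + k * crossing p E k t) := by
  refine Nat.sInf_mem (s := {n | RootBound p E n (t + k * n)}) ?_
  obtain ⟨r, -, -, h⟩ := exists_crossing_bounds hE hk
  obtain ⟨l, hl, hlt, -⟩ := h (r + 1) (by linarith)
  have hev : ∀ᶠ n : ℕ in atTop, (t : ℝ) / l ≤ n :=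
    tendsto_natCast_atTop_atTop.eventually_ge_atTop _
  obtain ⟨n, h1, h2⟩ := ((rootBound_of_lt hE hlt).and hev).exists
  refine ⟨n, h1 t ?_⟩
  rw [div_le_iff₀ hl] at h2
  linarith

theorem tendsto_crossing {p : ℕ} [Fact p.Prime] {E : Set ℤ} (hE : E.Nonempty) {k : ℕ}
    (hk : ((k : ℝ) : EReal) < valuativeCapacity p E) :
    ∃ r : ℝ, (r : EReal) = recip (valuativeCapacity p E - ((k : ℝ) : EReal)) ∧
      Tendsto (fun t : ℕ => (crossing p E k t : ℝ) / t) atTop (𝓝 r) := by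
  obtain ⟨r, hr, hlow, hup⟩ := exists_crossing_bounds hE hk
  refine ⟨r, hr, tendsto_order.2 ⟨fun a ha => ?_, fun b hb => ?_⟩⟩
  · filter_upwards [eventually_gt_atTop 0] with t ht
    have ht' : (0 : ℝ) < t := by exact_mod_cast ht
    refine ha.trans_le ?_
    rw [le_div_iff₀ ht']
    exact hlow _ t ht (crossing_spec hE hk t)
  · obtain ⟨l, hl, hlt, hlb⟩ := hup b hb
    obtain ⟨n₀, hn₀⟩ := eventually_atTop.1 (rootBound_of_lt hE hlt)
    have e1 : ∀ᶠ t : ℕ in atTop, (l * n₀ : ℝ) ≤ t :=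
      tendsto_natCast_atTop_atTop.eventually_ge_atTop _
    have e2 : ∀ᶠ t : ℕ in atTop, 1 / (b - 1 / l) < (t : ℝ) :=
      tendsto_natCast_atTop_atTop.eventually_gt_atTop _
    filter_upwards [e1, e2, eventually_gt_atTop 0] with t h1 h2 ht
    have ht' : (0 : ℝ) < t := by exact_mod_cast ht
    have h3 : (t : ℝ) / l ≤ ⌈(t : ℝ) / l⌉₊ := Nat.le_ceil _
    have h4 : (⌈(t : ℝ) / l⌉₊ : ℝ) < t / l + 1 := Nat.ceil_lt_add_one (by positivity)
    have h5 : n₀ ≤ ⌈(t : ℝ) / l⌉₊ := by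
      have : (n₀ : ℝ) ≤ ⌈(t : ℝ) / l⌉₊ := by
        refine le_trans ?_ h3
        rw [le_div_iff₀ hl]
        linarith
      exact_mod_cast this
    -- The degree `⌈t / l⌉₊` already qualifies, so the crossing is below `t / l + 1`, which is less
    -- than `b * t` for large `t`.
    have h6 : crossing p E k t ≤ ⌈(t : ℝ) / l⌉₊ := by
      refine Nat.sInf_le (hn₀ _ h5 t ?_)
      rw [div_le_iff₀ hl] at h3
      linarith
    have h7 : (crossing p E k t : ℝ) ≤ ⌈(t : ℝ) / l⌉₊ := by exact_mod_cast h6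
    rw [div_lt_iff₀ (sub_pos.2 hlb)] at h2
    rw [div_lt_iff₀ ht']
    have h8 : (t : ℝ) / l = 1 / l * t := by ring
    linarith

/-- Each further root in `E` contributes a factor `p ^ k`, so the admissible degrees form an up-set.
-/
theorem rootBound_of_crossing_le {p : ℕ} [Fact p.Prime] {E : Set ℤ} (hE : E.Nonempty) {k : ℕ}
    (h : ∀ x ∈ E, ∀ y ∈ E, (p : ℤ) ^ k ∣ x - y) {n t : ℕ} (hn : crossing p E k t ≤ n) :
    RootBound p E n (t + k * n) := by
  obtain ⟨d, rfl⟩ := Nat.exists_eq_add_of_le hn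
  obtain ⟨e, he⟩ := id hE
  have h1 : RootBound p E d (k * d) := by
    refine ⟨Multiset.replicate d e, fun j hj => Multiset.eq_of_mem_replicate hj ▸ he, by simp,
      fun x hx => ?_⟩
    rw [Multiset.map_replicate, Multiset.prod_replicate, pow_mul]
    exact pow_dvd_pow_of_dvd (h x hx e he) d
  have h2 := (crossing_spec hE (lt_valuativeCapacity hE h) t).add h1
  rwa [add_assoc, ← mul_add] at h2

/-! ### Unions at constant mutual valuation -/

theorem pow_dvd_multiset_prod {p k : ℕ} {x : ℤ} (T : Multiset ℤ)
    (h : ∀ j ∈ T, (p : ℤ) ^ k ∣ x - j) : (p : ℤ) ^ (k * T.card) ∣ (T.map fun j => x - j).prod := by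
  induction T using Multiset.induction_on with
  | empty => simp
  | cons a s ih =>
    rw [Multiset.card_cons, Multiset.map_cons, Multiset.prod_cons, mul_add, mul_one, add_comm,
      pow_add]
    exact mul_dvd_mul (h a (Multiset.mem_cons_self a s))
      (ih fun j hj => h j (Multiset.mem_cons_of_mem hj))

theorem RootBound.union {p k : ℕ} {A B : Set ℤ} (h : ∀ a ∈ A, ∀ b ∈ B, (p : ℤ) ^ k ∣ a - b)
    {m n t : ℕ} (hA : RootBound p A m (t + k * m)) (hB : RootBound p B n (t + k * n)) :
    RootBound p (A ∪ B) (m + n) (t + k * (m + n)) := by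
  obtain ⟨T, h1, rfl, h3⟩ := hA
  obtain ⟨T', h1', rfl, h3'⟩ := hB
  refine ⟨T + T', ?_, by simp, fun x hx => ?_⟩
  · intro j hj
    rcases Multiset.mem_add.1 hj with hj | hj
    exacts [Or.inl (h1 j hj), Or.inr (h1' j hj)]
  · rw [Multiset.map_add, Multiset.prod_add, mul_add]
    rcases hx with hx | hx
    · rw [← add_assoc, pow_add]
      exact mul_dvd_mul (h3 x hx) (pow_dvd_multiset_prod _ fun j hj => h x hx j (h1' j hj))
    · rw [add_left_comm, pow_add]
      exact mul_dvd_mul (pow_dvd_multiset_prod _ fun j hj => dvd_sub_comm.1 (h j (h1 j hj) x hx))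
        (h3' x hx)

/-- Adjoining to `S` points at distance exactly `p ^ (-k)` from `i`. -/
theorem not_pow_dvd_prod_erase_union {p : ℕ} [Fact p.Prime] {k N : ℕ} {S S' : Finset ℤ}
    {i : ℤ} (hS : ¬ (p : ℤ) ^ N ∣ ∏ j ∈ S.erase i, (i - j))
    (hval : ∀ j ∈ S', i - j ≠ 0 ∧ padicValInt p (i - j) = k) :
    ¬ (p : ℤ) ^ (N + k * S'.card) ∣ ∏ j ∈ (S ∪ S').erase i, (i - j) := by
  have hi' : i ∉ S' := fun h => (hval i h).1 (sub_self i)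
  have hne : ∀ j ∈ (S ∪ S').erase i, i - j ≠ 0 := fun j hj h0 =>
    Finset.ne_of_mem_erase hj (sub_eq_zero.1 h0).symm
  rw [pow_dvd_prod_iff_le_sum_padicValInt _ _ hne]
  rw [pow_dvd_prod_iff_le_sum_padicValInt _ _ fun j hj h0 =>
    Finset.ne_of_mem_erase hj (sub_eq_zero.1 h0).symm] at hS
  have h1 : (S ∪ S').erase i = S.erase i ∪ S' := by
    rw [Finset.erase_union_distrib, Finset.erase_eq_of_notMem hi']
  have h2 : ∑ j ∈ S', padicValInt p (i - j) = k * S'.card := by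
    rw [Finset.sum_congr rfl fun j hj => (hval j hj).2, Finset.sum_const, smul_eq_mul, mul_comm]
  have h3 := Finset.sum_union_inter (s₁ := S.erase i) (s₂ := S')
    (f := fun j => padicValInt p (i - j))
  rw [h1]
  omega

/-- Valuation `k` between `A` and `B` makes the crossing degrees add up. -/
theorem crossing_union {p : ℕ} [Fact p.Prime] {k : ℕ} {A B : Set ℤ} (hA : A.Nonempty)
    (hB : B.Nonempty) (hne : ∀ a ∈ A, ∀ b ∈ B, a - b ≠ 0)
    (hval : ∀ a ∈ A, ∀ b ∈ B, padicValInt p (a - b) = k)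
    (hAB : ∀ x ∈ A ∪ B, ∀ y ∈ A ∪ B, (p : ℤ) ^ k ∣ x - y) {t : ℕ} (ht : 0 < t) :
    crossing p (A ∪ B) k t = crossing p A k t + crossing p B k t := by
  have hkA : ∀ x ∈ A, ∀ y ∈ A, (p : ℤ) ^ k ∣ x - y := fun x hx y hy =>
    hAB x (Or.inl hx) y (Or.inl hy)
  have hkB : ∀ x ∈ B, ∀ y ∈ B, (p : ℤ) ^ k ∣ x - y := fun x hx y hy =>
    hAB x (Or.inr hx) y (Or.inr hy)
  have hU : (A ∪ B).Nonempty := hA.inl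
  have fek : ∀ E : Set ℤ, E.Nonempty → (∀ x ∈ E, ∀ y ∈ E, (p : ℤ) ^ k ∣ x - y) →
      ∃ n, crossing p E k t = n + 1 ∧ ∃ S : Finset ℤ, ↑S ⊆ E ∧ S.card = n + 1 ∧
        ∀ i ∈ S, ¬ (p : ℤ) ^ (t + k * n) ∣ ∏ j ∈ S.erase i, (i - j) := by
    intro E hE hkE
    have h0 := (crossing_spec hE (lt_valuativeCapacity hE hkE) t).pos hE (by omega)
    obtain ⟨n, hn⟩ := Nat.exists_eq_add_of_lt h0
    rw [zero_add] at hn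
    refine ⟨n, hn, (rootBound_iff_not_exists_finset hE _ _).1 fun h => ?_⟩
    have : crossing p E k t ≤ n := Nat.sInf_le h
    omega
  refine le_antisymm (Nat.sInf_le ?_) (le_of_not_gt fun hlt => ?_)
  · refine RootBound.union (fun a ha b hb => hAB a (Or.inl ha) b (Or.inr hb))
      (crossing_spec hA (lt_valuativeCapacity hA hkA) t)
      (crossing_spec hB (lt_valuativeCapacity hB hkB) t)
  · obtain ⟨m, hm, S, hSA, hSc, hS⟩ := fek A hA hkA
    obtain ⟨n, hn, S', hSB, hSc', hS'⟩ := fek B hB hkB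
    rw [hm, hn] at hlt
    -- The certificates have `m + 1` and `n + 1` points, so their union excludes degree `m + 1 + n`,
    -- one below the sum of the crossings. At a point of `S` the exponents add up as `t + k * m + k
    -- * (n + 1)`.
    have hR := rootBound_of_crossing_le hU hAB (n := m + 1 + n) (t := t) (by omega)
    refine (rootBound_iff_not_exists_finset hU _ _).2 ⟨S ∪ S', ?_, ?_, ?_⟩ hR
    · rw [Finset.coe_union]
      exact Set.union_subset_union hSA hSB
    · rw [Finset.card_union_of_disjoint, hSc, hSc']
      · rfl
      · exact Finset.disjoint_left.2 fun x hx hx' => hne x (hSA hx) x (hSB hx') (sub_self x)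
    · intro i hi
      rcases Finset.mem_union.1 hi with hi | hi
      · have := not_pow_dvd_prod_erase_union (hS i hi)
          fun j hj => ⟨hne i (hSA hi) j (hSB hj), hval i (hSA hi) j (hSB hj)⟩
        rw [hSc'] at this
        convert this using 2
        ring
      · have := not_pow_dvd_prod_erase_union (S' := S) (hS' i hi)
          fun j hj => ⟨fun h0 => hne j (hSA hj) i (hSB hi) (by omega),
            (padicValInt_sub_comm i j).trans (hval j (hSA hj) i (hSB hi))⟩
        rw [hSc, Finset.union_comm] at this
        convert this using 2
        ring

/-- Capacities, lowered by the common valuation `k` of the differences `a - b`, add harmonically. -/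
theorem recip_valuativeCapacity_union {p : ℕ} [Fact p.Prime] {k : ℕ} {A B : Set ℤ}
    (hdisj : Disjoint A B) (hval : ∀ a ∈ A, ∀ b ∈ B, padicValInt p (a - b) = k) :
    recip (valuativeCapacity p (A ∪ B) - ((k : ℝ) : EReal)) =
      recip (valuativeCapacity p A - ((k : ℝ) : EReal)) +
        recip (valuativeCapacity p B - ((k : ℝ) : EReal)) := by
  rcases A.eq_empty_or_nonempty with rfl | hA
  · rw [valuativeCapacity_empty, EReal.top_sub_coe, recip_top, Set.empty_union, zero_add]
  rcases B.eq_empty_or_nonempty with rfl | hB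
  · rw [valuativeCapacity_empty, EReal.top_sub_coe, recip_top, Set.union_empty, add_zero]
  -- Disjointness is needed because `padicValInt p 0 = 0` would satisfy `hval` when `k = 0`.
  have hne : ∀ a ∈ A, ∀ b ∈ B, a - b ≠ 0 := fun a ha b hb h0 =>
    Set.disjoint_left.1 hdisj ha (sub_eq_zero.1 h0 ▸ hb)
  have hdvd : ∀ a ∈ A, ∀ b ∈ B, (p : ℤ) ^ k ∣ a - b := fun a ha b hb =>
    hval a ha b hb ▸ padicValInt_dvd _
  obtain ⟨a₀, ha₀⟩ := id hA
  obtain ⟨b₀, hb₀⟩ := id hB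
  have hkA : ∀ x ∈ A, ∀ y ∈ A, (p : ℤ) ^ k ∣ x - y := fun x hx y hy => by
    simpa using dvd_sub (hdvd x hx b₀ hb₀) (hdvd y hy b₀ hb₀)
  have hkB : ∀ x ∈ B, ∀ y ∈ B, (p : ℤ) ^ k ∣ x - y := fun x hx y hy => by
    simpa using dvd_sub (hdvd a₀ ha₀ y hy) (hdvd a₀ ha₀ x hx)
  have hAB : ∀ x ∈ A ∪ B, ∀ y ∈ A ∪ B, (p : ℤ) ^ k ∣ x - y := by
    rintro x (hx | hx) y (hy | hy)
    exacts [hkA x hx y hy, hdvd x hx y hy, dvd_sub_comm.1 (hdvd y hy x hx), hkB x hx y hy]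
  obtain ⟨r, hr, htr⟩ := tendsto_crossing hA (lt_valuativeCapacity hA hkA)
  obtain ⟨s, hs, hts⟩ := tendsto_crossing hB (lt_valuativeCapacity hB hkB)
  obtain ⟨u, hu, htu⟩ := tendsto_crossing (E := A ∪ B) hA.inl (lt_valuativeCapacity hA.inl hAB)
  have hsum : Tendsto (fun t : ℕ => (crossing p (A ∪ B) k t : ℝ) / t) atTop (𝓝 (r + s)) := by
    refine (htr.add hts).congr' ?_
    filter_upwards [eventually_gt_atTop 0] with t ht
    rw [crossing_union hA hB hne hval hAB ht, Nat.cast_add, add_div]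
  rw [← hr, ← hs, ← hu, tendsto_nhds_unique htu hsum, EReal.coe_add]

/-! ### Unrolling the continued fraction -/

theorem contFrac_range' {p m : ℕ} [Fact p.Prime] {A : ℕ → Set ℤ}
    (hdisj : ∀ k h : ℕ, k < h → h ≤ m → Disjoint (A k) (A h))
    (hval : ∀ k h : ℕ, k < h → h ≤ m → ∀ a ∈ A k, ∀ b ∈ A h, padicValInt p (a - b) = k)
    {c : ℕ → EReal}
    (hc_even : ∀ k : ℕ, k ≤ m - 1 →
      c (2 * k) = recip (valuativeCapacity p (A k) - ((k : ℝ) : EReal)))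
    (hc_odd : ∀ k : ℕ, k < m - 1 → c (2 * k + 1) = 1)
    (hc_last : c (2 * m - 1) = valuativeCapacity p (A m) - (((m : ℝ) - 1 : ℝ) : EReal))
    (d k : ℕ) (hd : k + d + 1 = m) :
    contFrac (c (2 * k)) ((List.range' (2 * k + 1) (2 * d + 1)).map c) =
      recip (valuativeCapacity p (⋃ j ∈ Set.Icc k m, A j) - ((k : ℝ) : EReal)) := by
  have hsplit : ∀ k ≤ m, (⋃ j ∈ Set.Icc k m, A j) = A k ∪ ⋃ j ∈ Set.Icc (k + 1) m, A j := by
    intro k hk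
    rw [← Set.biUnion_insert]
    congr! 3 with j
    rw [Set.mem_insert_iff, Set.mem_Icc, Set.mem_Icc]
    omega
  have hunion : ∀ k < m, c (2 * k) + recip (valuativeCapacity p (⋃ j ∈ Set.Icc (k + 1) m, A j) -
      ((k : ℝ) : EReal)) =
        recip (valuativeCapacity p (⋃ j ∈ Set.Icc k m, A j) - ((k : ℝ) : EReal)) := by
    intro k hk
    rw [hsplit k hk.le, hc_even k (by omega)]
    refine (recip_valuativeCapacity_union ?_ fun a ha b hb => ?_).symm
    · exact Set.disjoint_iUnion₂_right.2 fun j hj => hdisj k j hj.1 hj.2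
    · obtain ⟨j, hj, hb⟩ := Set.mem_iUnion₂.1 hb
      exact hval k j hj.1 hj.2 a ha b hb
  induction d generalizing k with
  | zero =>
    obtain rfl : m = k + 1 := by omega
    have h1 : 2 * (k + 1) - 1 = 2 * k + 1 := by omega
    have h2 : (((k + 1 : ℕ) : ℝ) - 1 : ℝ) = k := by push_cast; ring
    rw [h1, h2] at hc_last
    rw [← hunion k (by omega)]
    simp [contFrac, hc_last]
  | succ d ih =>
    have h1 : List.range' (2 * k + 1) (2 * (d + 1) + 1) =
        (2 * k + 1) :: (2 * (k + 1)) :: List.range' (2 * (k + 1) + 1) (2 * d + 1) := by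
      rw [show 2 * (d + 1) + 1 = 2 * d + 1 + 1 + 1 by ring, List.range'_succ, List.range'_succ]
      rfl
    rw [h1, List.map_cons, List.map_cons, contFrac, contFrac, ih (k + 1) (by omega),
      hc_odd k (by omega), ← hunion k (by omega)]
    have hbot := valuativeCapacity_ne_bot (p := p) (⋃ j ∈ Set.Icc (k + 1) m, A j)
    generalize valuativeCapacity p (⋃ j ∈ Set.Icc (k + 1) m, A j) = L at hbot
    -- What remains is `1 + (L - (k + 1)) = L - k`, where `L ≠ ⊥` allows the double reciprocal to
    -- cancel.
    congr 2
    induction L with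
    | bot => exact absurd rfl hbot
    | top => rw [EReal.top_sub_coe, EReal.top_sub_coe, recip_recip top_ne_bot]; rfl
    | coe L =>
      rw [← EReal.coe_sub, ← EReal.coe_sub, recip_recip (EReal.coe_ne_bot _), ← EReal.coe_one,
        ← EReal.coe_add]
      norm_cast
      push_cast
      ring

end ValCap

theorem mainTheorem4 (p : ℕ) (hp : p.Prime) (m : ℕ) (hm : 1 ≤ m) (A : ℕ → Set ℤ)
    (hdisj : ∀ k h : ℕ, k < h → h ≤ m → Disjoint (A k) (A h))
    (hval : ∀ k h : ℕ, k < h → h ≤ m → ∀ a ∈ A k, ∀ b ∈ A h, padicValInt p (a - b) = k)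
    (c : ℕ → EReal)
    (hc_even : ∀ k : ℕ, k ≤ m - 1 →
      c (2 * k) = ValCap.recip (ValCap.valuativeCapacity p (A k) - ((k : ℝ) : EReal)))
    (hc_odd : ∀ k : ℕ, k < m - 1 → c (2 * k + 1) = 1)
    (hc_last : c (2 * m - 1) =
      ValCap.valuativeCapacity p (A m) - (((m : ℝ) - 1 : ℝ) : EReal)) :
    (∀ k : ℕ, k ≤ m → ValCap.HasValuativeCapacity p (A k) (ValCap.valuativeCapacity p (A k))) ∧
    ValCap.HasValuativeCapacity p (⋃ k ≤ m, A k) (ValCap.valuativeCapacity p (⋃ k ≤ m, A k)) ∧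
    ValCap.valuativeCapacity p (⋃ k ≤ m, A k) =
      ValCap.contFrac 0 ((List.range (2 * m)).map c) := by
  have : Fact p.Prime := ⟨hp⟩
  refine ⟨fun k _ => ValCap.hasValuativeCapacity_valuativeCapacity _,
    ValCap.hasValuativeCapacity_valuativeCapacity _, ?_⟩
  obtain ⟨d, rfl⟩ := Nat.exists_eq_add_of_le' hm
  have key := ValCap.contFrac_range' hdisj hval hc_even hc_odd hc_last d 0 (by omega)
  have hset : (⋃ j ∈ Set.Icc 0 (d + 1), A j) = ⋃ k ≤ d + 1, A k := by
    simp only [Set.mem_Icc, zero_le, true_and]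
  rw [List.range_eq_range', show 2 * (d + 1) = 2 * d + 1 + 1 by ring, List.range'_succ,
    List.map_cons, ValCap.contFrac, zero_add, zero_add]
  rw [mul_zero, zero_add, hset, Nat.cast_zero, EReal.coe_zero, sub_zero] at key
  rw [key, ValCap.recip_recip (ValCap.valuativeCapacity_ne_bot _)]
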